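/- For graphs $G$ and $H$, let $r(G,H)$ denote the Ramsey number, i.e. the smallest natural number $N$ such that every red/blue edge-coloring of the complete graph $K_N$ on $N$ vertices contains a red copy of $G$ or a blue copy of $H$. Let $Q_n$ be the hypercube, i.e. the graph on the vertex set $\{0,1\}^n$ in which two vertices are joined by an edge if and only if they differ in exactly one coordinate, and let $K_s$ be the complete graph on $s$ vertices. For every natural number $s \ge 3$ there exists a constant $c_s$, depending only on $s$, such that $$r(Q_n, K_s) \le c_s\, 2^n \qquad \text{for all natural numbers } n.$$ -/

import Mathlib

/-- The hypercube `Q_n`: the vertex set is `{0,1}^n`, and two vertices are adjacent if and only if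
they differ in exactly one coordinate. -/
def hypercube (n : ℕ) : SimpleGraph (Fin n → Bool) where
  Adj x y := ∃! i, x i ≠ y i
  symm := ⟨fun x y h => by simpa only [ne_comm] using h⟩
  loopless := ⟨fun x h => by
    obtain ⟨i, hi, -⟩ := h
    exact hi rfl⟩

/-- Every red/blue edge-colouring of the complete graph on `N` vertices contains a red copy of `G`
or a blue copy of `H` (not necessarily induced). The colour red is `true`, blue is `false`. -/
def RamseyProperty {α β : Type*} (G : SimpleGraph α) (H : SimpleGraph β) (N : ℕ) : Prop :=
  ∀ C : SimpleGraph.TopEdgeLabeling (Fin N) Bool,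
    G.IsContained (C.labelGraph true) ∨ H.IsContained (C.labelGraph false)

/-- The Ramsey number `r(G, H)`: the smallest `N` with the Ramsey property. -/
noncomputable def ramseyNumber {α β : Type*} (G : SimpleGraph α) (H : SimpleGraph β) : ℕ :=
  sInf {N : ℕ | RamseyProperty G H N}

/-! Let `B` be the blue graph, free of `T`-cliques, on `C T * 2 ^ n` vertices; an injection of the
cube that sends no cube edge to an edge of `B` is a red cube. A neighbourhood in a set without
(t+1)-cliques has no t-clique. Hence a cell of type t+1 can be cut greedily into large pieces of
neighbourhoods, which have type t, and leftover single vertices, which have type 0. Removing larger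
neighbourhoods first leaves few edges from a piece to the pieces that are not larger
(`exists_partition`).

The whole cube starts in one cell. Taking piece dimensions in decreasing order, a subcube of
dimension D repeatedly moves into an available piece of dimension D, which lowers its type. An edge
of the cube in direction i, once its ends are separated, has a weight ω < 1, and the density of `B`
between an available piece at one end and the cell at the other is kept at most ω to the power (sum
of the two types) + 1. A drop in type allows a factor 1/ω more density, so by Markov's inequality
discarding a fraction ω of the neighbouring cell restores the invariant (`sum_bad_le`). In the end
all types are 0, the density is below 1, and so no edge of `B` is present.

The process cannot get stuck: in a cell, moved points use at most half of the vertices and discarded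
pieces at most a quarter (`Valid.typ_eq_zero`). This needs weights whose sum over all directions is
bounded independently of n. Geometric decay in the distance from i to the dimension of the cell
achieves this (`exists_isWeight`). -/

/-- A set of vertices to which a subcube of dimension `dim` is assigned; `typ` bounds its cliques. -/
structure Cell (V : Type*) where
  carrier : Finset V
  typ : ℕ
  dim : ℕ

/-! ### Edge counts, and the greedy subdivision of a cell. -/

section Cells

open scoped Classical
open Finset

variable {V : Type*}

/-- The number of pairs in `S ×ˢ T` that are adjacent in `B`. -/
noncomputable def edgeCount (B : SimpleGraph V) (S T : Finset V) : ℕ := #(B.interedges S T)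

/-- The union of the carriers of a family of cells. -/
noncomputable def support (P : Finset (Cell V)) : Finset V := P.biUnion Cell.carrier

lemma carrier_subset_support {P : Finset (Cell V)} {p : Cell V} (hp : p ∈ P) :
    p.carrier ⊆ support P := subset_biUnion_of_mem _ hp

lemma support_mono {P Q : Finset (Cell V)} (h : P ⊆ Q) : support P ⊆ support Q :=
  biUnion_subset_biUnion_of_subset_left _ h

lemma mem_support {P : Finset (Cell V)} {v : V} : v ∈ support P ↔ ∃ p ∈ P, v ∈ p.carrier := by
  simp [support]

lemma edgeCount_mono (B : SimpleGraph V) {S S' T T' : Finset V} (hS : S ⊆ S') (hT : T ⊆ T') :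
    edgeCount B S T ≤ edgeCount B S' T' :=
  card_le_card (SimpleGraph.interedges_mono B hS hT)

lemma edgeCount_comm (B : SimpleGraph V) (S T : Finset V) :
    edgeCount B S T = edgeCount B T S := by
  have := B.symm
  exact Rel.card_interedges_comm S T

lemma sum_edgeCount (B : SimpleGraph V) {P : Finset (Cell V)}
    (hP : (P : Set (Cell V)).PairwiseDisjoint Cell.carrier) (T : Finset V) :
    ∑ p ∈ P, edgeCount B p.carrier T = edgeCount B (support P) T := by
  unfold edgeCount support
  rw [SimpleGraph.interedges_biUnion_left, card_biUnion]
  intro p hp q hq hpq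
  exact SimpleGraph.interedges_disjoint_left _ (hP hp hq hpq) _

lemma edgeCount_le_of_degree (B : SimpleGraph V) {S T : Finset V} {k : ℕ}
    (h : ∀ v ∈ S, #{u ∈ T | B.Adj v u} ≤ k) : edgeCount B S T ≤ #S * k := by
  have : edgeCount B S T = ∑ v ∈ S, #{u ∈ T | B.Adj v u} := by
    unfold edgeCount
    rw [SimpleGraph.interedges_def, card_filter, sum_product]
    simp only [card_filter]
  rw [this]
  exact sum_le_card_nsmul _ _ _ h

/-- Members of a disjoint family whose edge density into `T` is large have small total size. -/
lemma mul_sum_card_le (B : SimpleGraph V) {P Q : Finset (Cell V)}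
    (hP : (P : Set (Cell V)).PairwiseDisjoint Cell.carrier) (hQP : Q ⊆ P) (T : Finset V) {τ : ℝ}
    (hQ : ∀ q ∈ Q, τ * #q.carrier ≤ edgeCount B q.carrier T) :
    τ * ∑ q ∈ Q, (#q.carrier : ℝ) ≤ edgeCount B (support P) T := by
  rw [mul_sum]
  calc ∑ q ∈ Q, τ * (#q.carrier : ℝ) ≤ ∑ q ∈ Q, (edgeCount B q.carrier T : ℝ) := sum_le_sum hQ
    _ = ((∑ q ∈ Q, edgeCount B q.carrier T : ℕ) : ℝ) := by push_cast; rfl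
    _ ≤ _ := by
      rw [sum_edgeCount B (hP.subset (by exact_mod_cast hQP))]
      exact_mod_cast edgeCount_mono B (support_mono hQP) subset_rfl

/-- The cells that may occur: the size is prescribed by type and dimension, cells of type `0` are
singletons, and other cells of type `t` contain no `t`-clique of `B`. -/
structure IsCell (B : SimpleGraph V) (C : ℕ → ℕ) (c : Cell V) : Prop where
  card_eq : #c.carrier = C c.typ * 2 ^ c.dim
  dim_eq : c.typ = 0 → c.dim = 0
  cliqueFree : c.typ ≠ 0 → B.CliqueFreeOn c.carrier c.typ

/-- A partition of a cell into cells of smaller type, such that vertices of a piece have few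
neighbours in the pieces which are not larger. -/
structure IsSubdivision (B : SimpleGraph V) (C : ℕ → ℕ) (c : Cell V) (P : Finset (Cell V)) :
    Prop where
  isCell : ∀ p ∈ P, IsCell B C p
  typ_lt : ∀ p ∈ P, p.typ < c.typ
  dim_le : ∀ p ∈ P, p.dim ≤ c.dim
  disjoint : (P : Set (Cell V)).PairwiseDisjoint Cell.carrier
  support_eq : support P = c.carrier
  degree_le : ∀ p ∈ P, p.dim < c.dim → ∀ v ∈ p.carrier,
    #{u ∈ support {q ∈ P | q.dim ≤ p.dim} | B.Adj v u} ≤ C (c.typ - 1) * 2 ^ (p.dim + 1)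

/-- Induction on the scale D still allowed, with an inner induction on the size of the remainder R.
While some vertex has `C t * 2 ^ D` neighbours in R, that many of them are split off as a piece of
type t; otherwise the scale drops. At scale 0 the remainder falls into single vertices. No degree
bound is available at the top scale D = d, so none is asked of pieces of dimension d. -/
lemma exists_partition (B : SimpleGraph V) {C : ℕ → ℕ} (hC : ∀ t, 0 < C t) (hC0 : C 0 = 1)
    (t d : ℕ) (D : ℕ) : D ≤ d → ∀ (m : ℕ) (R : Finset V), #R = m → B.CliqueFreeOn R (t + 1) →
    (D < d → ∀ v ∈ R, #{u ∈ R | B.Adj v u} ≤ C t * 2 ^ (D + 1)) →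
    ∃ P : Finset (Cell V), (∀ p ∈ P, IsCell B C p ∧ p.typ < t + 1 ∧ p.dim ≤ D) ∧
      (P : Set (Cell V)).PairwiseDisjoint Cell.carrier ∧ support P = R ∧
      ∀ p ∈ P, p.dim < d → ∀ v ∈ p.carrier,
        #{u ∈ support {q ∈ P | q.dim ≤ p.dim} | B.Adj v u} ≤ C t * 2 ^ (p.dim + 1) := by
  induction D with
  | zero =>
    intro hD m R hm hR hdeg
    refine ⟨R.image fun v => ⟨{v}, 0, 0⟩, ?_, ?_, ?_, ?_⟩
    · intro p hp
      obtain ⟨v, hv, rfl⟩ := mem_image.1 hp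
      exact ⟨⟨by simp [hC0], fun _ => rfl, fun h => absurd rfl h⟩, by simp, le_rfl⟩
    · intro p hp q hq hpq
      obtain ⟨v, hv, rfl⟩ := mem_image.1 (mem_coe.1 hp)
      obtain ⟨u, hu, rfl⟩ := mem_image.1 (mem_coe.1 hq)
      have : v ≠ u := fun h => hpq (by rw [h])
      simpa [Function.onFun] using this
    · ext v
      simp [support]
    · intro p hp hpd v hv
      obtain ⟨w, hw, rfl⟩ := mem_image.1 hp
      obtain rfl : v = w := by simpa using hv
      refine le_trans (card_le_card ?_) (hdeg hpd v hw)
      refine filter_subset_filter _ fun u hu => ?_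
      obtain ⟨q, hq, huq⟩ := mem_support.1 hu
      obtain ⟨x, hx, rfl⟩ := mem_image.1 (mem_filter.1 hq).1
      obtain rfl : u = x := by simpa using huq
      exact hx
  | succ D ih =>
    intro hD m
    induction m using Nat.strong_induction_on with
    | _ m ihm =>
    intro R hm hR hdeg
    by_cases hbig : ∃ v ∈ R, C t * 2 ^ (D + 1) ≤ #{u ∈ R | B.Adj v u}
    · obtain ⟨v, hv, hbig⟩ := hbig
      obtain ⟨A, hA, hAcard⟩ := exists_subset_card_eq hbig
      have hAR : A ⊆ R := hA.trans (filter_subset _ _)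
      -- For t = 0 the set R has no 1-clique, so it is empty.
      have ht : t ≠ 0 := by
        rintro rfl
        refine hR (t := {v}) (by simpa using hv) ?_
        simp [SimpleGraph.isNClique_iff]
      have hApos : 0 < #A := by rw [hAcard]; have := hC t; positivity
      have hlt : #(R \ A) < m := by
        rw [card_sdiff_of_subset hAR]; have := card_le_card hAR; omega
      obtain ⟨P, hP1, hP2, hP3, hP4⟩ := ihm _ hlt (R \ A) rfl
        (SimpleGraph.CliqueFreeOn.subset B (by exact_mod_cast sdiff_subset) hR)
        (fun hDd u hu => (card_le_card (filter_subset_filter _ sdiff_subset)).trans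
          (hdeg hDd u (sdiff_subset hu)))
      have hdisj : ∀ p ∈ P, Disjoint A p.carrier := by
        intro p hp
        refine disjoint_of_subset_right (carrier_subset_support hp) ?_
        rw [hP3]
        exact disjoint_sdiff
      have hsupp : support (insert ⟨A, t, D + 1⟩ P) = R := by
        have : support (insert ⟨A, t, D + 1⟩ P) = A ∪ support P := by
          unfold support; rw [biUnion_insert]
        rw [this, hP3, union_sdiff_of_subset hAR]
      -- Pieces of the current scale inherit the bound that holds throughout R, left by the previous
      -- scale.
      have hdim : ∀ p ∈ insert (⟨A, t, D + 1⟩ : Cell V) P, p.dim = D + 1 → p.dim < d →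
          ∀ v ∈ p.carrier, #{u ∈ support {q ∈ insert ⟨A, t, D + 1⟩ P | q.dim ≤ p.dim} | B.Adj v u}
            ≤ C t * 2 ^ (p.dim + 1) := by
        intro p hp hpD hpd u hu
        rw [hpD] at hpd
        have hle := hdeg hpd u (hsupp ▸ carrier_subset_support hp hu)
        rw [hpD]
        refine (card_le_card (filter_subset_filter _ ?_)).trans hle
        exact (support_mono (filter_subset _ _)).trans hsupp.subset
      refine ⟨insert ⟨A, t, D + 1⟩ P, ?_, ?_, hsupp, ?_⟩
      · intro p hp
        obtain rfl | hp := mem_insert.1 hp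
        · refine ⟨⟨hAcard, fun h => absurd h ht, fun _ => ?_⟩, Nat.lt_succ_self _, le_rfl⟩
          refine SimpleGraph.CliqueFreeOn.subset B (fun u hu => ?_)
            (hR.of_succ B (by exact_mod_cast hv))
          have := mem_filter.1 (hA hu)
          exact ⟨by exact_mod_cast this.1, this.2⟩
        · exact hP1 p hp
      · rw [coe_insert]
        exact hP2.insert fun q hq _ => hdisj q hq
      · intro p hp hpd
        by_cases hpD : p.dim = D + 1
        · exact hdim p hp hpD hpd
        · obtain rfl | hp := mem_insert.1 hp
          · exact absurd rfl hpD
          have := (hP1 p hp).2.2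
          rw [filter_insert, if_neg (by simp only; omega)]
          exact hP4 p hp hpd
    · push Not at hbig
      -- The failed search at scale D + 1 is exactly the degree bound required at scale D.
      obtain ⟨P, hP1, hP2⟩ := ih (by omega) m R hm hR fun _ v hv => (hbig v hv).le
      exact ⟨P, fun p hp => ⟨(hP1 p hp).1, (hP1 p hp).2.1, (hP1 p hp).2.2.trans (by omega)⟩, hP2⟩

lemma exists_isSubdivision (B : SimpleGraph V) {C : ℕ → ℕ} (hC : ∀ t, 0 < C t) (hC0 : C 0 = 1)
    {c : Cell V} (hc : IsCell B C c) (ht : c.typ ≠ 0) : ∃ P, IsSubdivision B C c P := by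
  obtain ⟨t, ht'⟩ := Nat.exists_eq_succ_of_ne_zero ht
  obtain ⟨P, h1, h2, h3, h4⟩ := exists_partition B hC hC0 t c.dim c.dim le_rfl _ c.carrier rfl
    (by have := hc.cliqueFree ht; rwa [ht'] at this) (fun h => absurd h (lt_irrefl _))
  refine ⟨P, fun p hp => (h1 p hp).1, fun p hp => ?_, fun p hp => (h1 p hp).2.2, h2, h3, ?_⟩
  · rw [ht']; exact (h1 p hp).2.1
  · rw [ht']; exact h4

end Cells

/-! ### Subcubes and neighbours in the hypercube. -/

section Cubes

open scoped Classical
open Finset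

variable {n : ℕ}

/-- The points `x` and `y` agree in all coordinates from `D` on, that is, they lie in the same
subcube of dimension `D` of the standard dissection. -/
def Agree (D : ℕ) (x y : Fin n → Bool) : Prop := ∀ i : Fin n, D ≤ i → x i = y i

/-- The point `x` with the coordinate `i` switched. -/
def flipAt (x : Fin n → Bool) (i : Fin n) : Fin n → Bool := Function.update x i (!x i)

lemma Agree.refl (D : ℕ) (x : Fin n → Bool) : Agree D x x := fun _ _ => rfl

lemma Agree.symm {D : ℕ} {x y : Fin n → Bool} (h : Agree D x y) : Agree D y x :=
  fun i hi => (h i hi).symm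

lemma Agree.trans {D : ℕ} {x y z : Fin n → Bool} (h : Agree D x y) (h' : Agree D y z) :
    Agree D x z := fun i hi => (h i hi).trans (h' i hi)

lemma Agree.mono {D E : ℕ} (hDE : D ≤ E) {x y : Fin n → Bool} (h : Agree D x y) : Agree E x y :=
  fun i hi => h i (hDE.trans hi)

lemma flipAt_flipAt (x : Fin n → Bool) (i : Fin n) : flipAt (flipAt x i) i = x := by
  simp [flipAt]

lemma agree_flipAt {D : ℕ} (x : Fin n → Bool) {i : Fin n} (hi : (i : ℕ) < D) :
    Agree D x (flipAt x i) := by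
  intro j hj
  have : j ≠ i := by rintro rfl; omega
  simp [flipAt, this]

lemma not_agree_flipAt {D : ℕ} (x : Fin n → Bool) {i : Fin n} (hi : D ≤ (i : ℕ)) :
    ¬ Agree D x (flipAt x i) := by
  intro h
  have := h i hi
  simp [flipAt] at this

lemma Agree.flipAt {D : ℕ} {x y : Fin n → Bool} (h : Agree D x y) (i : Fin n) :
    Agree D (flipAt x i) (flipAt y i) := by
  intro j hj
  by_cases hji : j = i
  · subst hji; simp [_root_.flipAt, h j hj]
  · simp [_root_.flipAt, hji, h j hj]

lemma card_agree (D : ℕ) (x : Fin n → Bool) :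
    #{y : Fin n → Bool | Agree D x y} = 2 ^ min n D := by
  have : univ.filter (fun y : Fin n → Bool => Agree D x y) =
      Fintype.piFinset fun i : Fin n => if (i : ℕ) < D then univ else {x i} := by
    ext y
    rw [mem_filter, Fintype.mem_piFinset]
    simp only [mem_univ, true_and, Agree]
    refine forall_congr' fun i => ?_
    by_cases hi : (i : ℕ) < D
    · simp [hi]
    · simp only [hi, if_false, mem_singleton, not_lt.1 hi, forall_true_left]
      exact eq_comm
  rw [this, Fintype.card_piFinset]
  have h2 : ∀ i : Fin n, #(if (i : ℕ) < D then (univ : Finset Bool) else {x i}) =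
      if (i : ℕ) < D then 2 else 1 := by
    intro i; split_ifs <;> simp
  simp only [h2, prod_ite, prod_const, one_pow, mul_one]
  congr 1
  rw [Fin.card_filter_val_lt]

lemma hypercube_adj_iff (x y : Fin n → Bool) :
    (hypercube n).Adj x y ↔ ∃ i, y = flipAt x i := by
  constructor
  · rintro ⟨i, hi, huniq⟩
    refine ⟨i, funext fun j => ?_⟩
    by_cases hj : j = i
    · subst hj
      simp only [flipAt, Function.update_self]
      revert hi; cases x j <;> cases y j <;> simp
    · have : ¬ x j ≠ y j := fun h => hj (huniq j h)
      simp only [flipAt, Function.update_of_ne hj]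
      exact (not_not.1 this).symm
  · rintro ⟨i, rfl⟩
    refine ⟨i, by simp [flipAt], fun j hj => ?_⟩
    by_contra h
    exact hj (by simp [flipAt, h])

end Cubes

/-! ### Numerical conditions, states and invariants of the embedding process. -/

section Embedding

open scoped Classical
open Finset

/-- The numerical conditions on the size factors `C`, indexed by type, and on the weights `w`,
indexed by the distance between a coordinate and the dimension of a cell. -/
structure IsWeight (T : ℕ) (C : ℕ → ℕ) (w : ℕ → ℝ) (S : ℝ) : Prop where
  zero_eq : C 0 = 1
  two_mul_le : ∀ t, 2 * C t ≤ C (t + 1)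
  pos : ∀ m, 0 < w m
  lt_one : ∀ m, w m < 1
  degree : ∀ t m, 2 * (C t : ℝ) ≤ w m ^ (2 * T) * C (t + 1) * 2 ^ m
  sum_le : ∀ D, ∑ i ∈ range D, w (D - i) ≤ S
  small : 4 * ((T : ℝ) + 1) ^ 2 * S ≤ 1

namespace IsWeight

variable {T : ℕ} {C : ℕ → ℕ} {w : ℕ → ℝ} {S : ℝ}

lemma const_pos (h : IsWeight T C w S) (t : ℕ) : 0 < C t := by
  induction t with
  | zero => rw [h.zero_eq]; exact one_pos
  | succ t ih => have := h.two_mul_le t; omega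

lemma const_mono (h : IsWeight T C w S) : Monotone C :=
  monotone_nat_of_le_succ fun t => by have := h.two_mul_le t; omega

lemma sum_nonneg (h : IsWeight T C w S) : 0 ≤ S := by
  have := h.sum_le 0
  simpa using this

lemma sum_fin_le (h : IsWeight T C w S) (n D : ℕ) :
    ∑ i : Fin n, (if (i : ℕ) < D then w (D - i) else 0) ≤ S := by
  rw [Fin.sum_univ_eq_sum_range (fun i => if i < D then w (D - i) else 0) n, ← sum_filter]
  refine le_trans (sum_le_sum_of_subset_of_nonneg ?_ fun i _ _ => (h.pos _).le) (h.sum_le D)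
  intro i hi
  exact mem_range.2 (mem_filter.1 hi).2

end IsWeight

/-- A partially constructed embedding of the cube: every point has a cell, a family of pieces of
that cell which are still available to it, and a weight for each of its coordinates. -/
structure State (n : ℕ) (V : Type*) where
  cell : (Fin n → Bool) → Cell V
  avail : (Fin n → Bool) → Finset (Cell V)
  wt : (Fin n → Bool) → Fin n → ℝ

variable {V : Type*} {n : ℕ} {B : SimpleGraph V} {T : ℕ} {C : ℕ → ℕ} {w : ℕ → ℝ} {S : ℝ}
  {pieces : Cell V → Finset (Cell V)} {D : ℕ} {σ : State n V}

/-- A choice of a subdivision for every cell; cells of type `0` are not subdivided. -/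
structure IsSubdivisionMap (B : SimpleGraph V) (C : ℕ → ℕ)
    (pieces : Cell V → Finset (Cell V)) : Prop where
  of_typ_ne : ∀ c, IsCell B C c → c.typ ≠ 0 → IsSubdivision B C c (pieces c)
  of_typ_eq : ∀ c, c.typ = 0 → pieces c = {c}

lemma IsSubdivisionMap.disjoint (hp : IsSubdivisionMap B C pieces) {c : Cell V}
    (hc : IsCell B C c) : (pieces c : Set (Cell V)).PairwiseDisjoint Cell.carrier := by
  by_cases h : c.typ = 0
  · rw [hp.of_typ_eq c h]; simp
  · exact (hp.of_typ_ne c hc h).disjoint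

lemma IsSubdivisionMap.support_eq (hp : IsSubdivisionMap B C pieces) {c : Cell V}
    (hc : IsCell B C c) : support (pieces c) = c.carrier := by
  by_cases h : c.typ = 0
  · rw [hp.of_typ_eq c h]; simp [support]
  · exact (hp.of_typ_ne c hc h).support_eq

lemma IsSubdivisionMap.dim_le (hp : IsSubdivisionMap B C pieces) {c q : Cell V}
    (hc : IsCell B C c) (hq : q ∈ pieces c) : q.dim ≤ c.dim := by
  by_cases h : c.typ = 0
  · rw [hp.of_typ_eq c h, mem_singleton] at hq; rw [hq]
  · exact (hp.of_typ_ne c hc h).dim_le q hq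

/-- The invariants of the construction at a time when all cells used are of dimension at least
`D`. Two neighbouring points are separated when one of them has a cell of dimension at most the
coordinate in which they differ. -/
structure Valid (B : SimpleGraph V) (T : ℕ) (C : ℕ → ℕ) (w : ℕ → ℝ) (S : ℝ)
    (pieces : Cell V → Finset (Cell V)) (D : ℕ) (σ : State n V) : Prop where
  isCell : ∀ z, IsCell B C (σ.cell z)
  typ_le : ∀ z, (σ.cell z).typ ≤ T
  avail_subset : ∀ z, σ.avail z ⊆ pieces (σ.cell z)
  avail_eq : ∀ z, (σ.cell z).typ = 0 → σ.avail z = {σ.cell z}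
  avail_dim : ∀ z, (σ.cell z).typ ≠ 0 → ∀ q ∈ σ.avail z, q.dim ≤ D
  cell_congr : ∀ y z, Agree D y z → σ.cell y = σ.cell z
  avail_congr : ∀ y z, Agree D y z → σ.avail y = σ.avail z
  wt_congr : ∀ y z, Agree D y z → σ.wt y = σ.wt z
  wt_flip : ∀ z (i : Fin n), σ.wt (flipAt z i) i = σ.wt z i
  wt_pos : ∀ z (i : Fin n), 0 < σ.wt z i
  wt_lt_one : ∀ z (i : Fin n), σ.wt z i < 1
  wt_eq : ∀ z (i : Fin n), (i : ℕ) < (σ.cell z).dim → σ.wt z i = w ((σ.cell z).dim - i)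
  wt_sum : ∀ z, ∑ i, σ.wt z i ≤ (T + 1 - (σ.cell z).typ) * S
  cell_flip : ∀ z (i : Fin n), (i : ℕ) < (σ.cell z).dim → (i : ℕ) < (σ.cell (flipAt z i)).dim →
    σ.cell z = σ.cell (flipAt z i)
  -- The exponent involves the type of the piece `q`, not of the cell of z. This reserves one factor
  -- of the weight for the next move of z.
  sparse : ∀ z (i : Fin n), (σ.cell z).dim ≤ (i : ℕ) ∨ (σ.cell (flipAt z i)).dim ≤ (i : ℕ) →
    ∀ q ∈ σ.avail z, (edgeCount B q.carrier (support (σ.avail (flipAt z i))) : ℝ) ≤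
      σ.wt z i ^ (q.typ + (σ.cell (flipAt z i)).typ + 1) *
        (#q.carrier * #(σ.cell (flipAt z i)).carrier)
  -- The three terms account for vertices still available, used by points that moved on, and
  -- discarded. Each unit drop in the type of the neighbour in direction i pays for discarding a
  -- fraction `σ.wt z i` of the cell.
  budget : ∀ z, (σ.cell z).typ ≠ 0 → (#(σ.cell z).carrier : ℝ) ≤
    ∑ q ∈ σ.avail z, (#q.carrier : ℝ) +
      C ((σ.cell z).typ - 1) *
        #{y | Agree (σ.cell z).dim z y ∧ (σ.cell y).typ < (σ.cell z).typ} +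
      #(σ.cell z).carrier * ∑ i, (T + 1 - (σ.cell (flipAt z i)).typ) * σ.wt z i
  disjoint : ∀ y z, (σ.cell y = σ.cell z ∧ Agree (σ.cell y).dim y z) ∨
    Disjoint (support (σ.avail y)) (support (σ.avail z))

/-! ### A single move of a subcube, and preservation of the invariants. -/

/-- The cells after the subcube of `z₀` has moved to the piece `p`. -/
noncomputable def State.newCell (σ : State n V) (z₀ : Fin n → Bool) (p : Cell V)
    (z : Fin n → Bool) : Cell V :=
  if Agree p.dim z₀ z then p else σ.cell z

/-- The available pieces after the subcube of `z₀` has moved to the piece `p`, before those which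
have become too dense are removed. -/
noncomputable def State.preAvail (σ : State n V) (pieces : Cell V → Finset (Cell V))
    (z₀ : Fin n → Bool) (p : Cell V) (z : Fin n → Bool) : Finset (Cell V) :=
  if Agree p.dim z₀ z then pieces p
  else if σ.cell z = σ.cell z₀ ∧ Agree (σ.cell z₀).dim z₀ z then (σ.avail z).erase p
  else σ.avail z

/-- The directions in which exactly one of `z` and its neighbour lies in the subcube of `z₀`. -/
def Crossing (z₀ : Fin n → Bool) (D : ℕ) (z : Fin n → Bool) (i : Fin n) : Prop :=
  Agree D z₀ z ↔ ¬ Agree D z₀ (flipAt z i)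

/-- The piece `q` is sparse enough towards the neighbour of `z` in direction `i`. -/
def State.Good (σ : State n V) (B : SimpleGraph V) (pieces : Cell V → Finset (Cell V))
    (z₀ : Fin n → Bool) (p : Cell V) (z : Fin n → Bool) (q : Cell V) (i : Fin n) : Prop :=
  (edgeCount B q.carrier (support (σ.preAvail pieces z₀ p (flipAt z i))) : ℝ) ≤
    σ.wt z i ^ (q.typ + (σ.newCell z₀ p (flipAt z i)).typ + 1) *
      (#q.carrier * #(σ.newCell z₀ p (flipAt z i)).carrier)

/-- The state in which the subcube of `z₀` has moved to the piece `p`. -/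
noncomputable def State.refine (σ : State n V) (B : SimpleGraph V) (w : ℕ → ℝ)
    (pieces : Cell V → Finset (Cell V)) (z₀ : Fin n → Bool) (p : Cell V) : State n V where
  cell := σ.newCell z₀ p
  avail z := {q ∈ σ.preAvail pieces z₀ p z | ∀ i, Crossing z₀ p.dim z i →
    σ.Good B pieces z₀ p z q i}
  wt z i := if Agree p.dim z₀ z ∧ (i : ℕ) < p.dim then w (p.dim - i) else σ.wt z i

lemma agree_flipAt_iff (z₀ z : Fin n → Bool) {i : Fin n} (hi : (i : ℕ) < D) :
    Agree D z₀ (flipAt z i) ↔ Agree D z₀ z :=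
  ⟨fun h => h.trans (agree_flipAt z hi).symm, fun h => h.trans (agree_flipAt z hi)⟩

lemma Crossing.le {z₀ z : Fin n → Bool} {i : Fin n} (h : Crossing z₀ D z i) : D ≤ (i : ℕ) := by
  by_contra! hi
  have := agree_flipAt_iff z₀ z hi
  unfold Crossing at h
  tauto

lemma Crossing.flip {z₀ z : Fin n → Bool} {i : Fin n} (h : Crossing z₀ D z i) :
    Crossing z₀ D (flipAt z i) i := by
  unfold Crossing at *
  rw [flipAt_flipAt]
  tauto

/-- The hypotheses of a single step: a piece `p` of dimension `D` is available at `z₀`. -/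
structure IsStep (B : SimpleGraph V) (T : ℕ) (C : ℕ → ℕ) (w : ℕ → ℝ) (S : ℝ)
    (pieces : Cell V → Finset (Cell V)) (σ : State n V) (z₀ : Fin n → Bool) (p : Cell V) :
    Prop where
  weight : IsWeight T C w S
  subdiv : IsSubdivisionMap B C pieces
  valid : Valid B T C w S pieces p.dim σ
  dim_le : p.dim ≤ n
  typ_ne : (σ.cell z₀).typ ≠ 0
  mem : p ∈ σ.avail z₀

namespace IsStep

variable {z₀ z : Fin n → Bool} {p : Cell V} {i : Fin n}

lemma isSubdivision (h : IsStep B T C w S pieces σ z₀ p) :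
    IsSubdivision B C (σ.cell z₀) (pieces (σ.cell z₀)) :=
  h.subdiv.of_typ_ne _ (h.valid.isCell z₀) h.typ_ne

lemma mem_pieces (h : IsStep B T C w S pieces σ z₀ p) : p ∈ pieces (σ.cell z₀) :=
  h.valid.avail_subset z₀ h.mem

lemma isCell (h : IsStep B T C w S pieces σ z₀ p) : IsCell B C p :=
  h.isSubdivision.isCell p h.mem_pieces

lemma typ_lt (h : IsStep B T C w S pieces σ z₀ p) : p.typ < (σ.cell z₀).typ :=
  h.isSubdivision.typ_lt p h.mem_pieces

lemma dim_le_dim (h : IsStep B T C w S pieces σ z₀ p) : p.dim ≤ (σ.cell z₀).dim :=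
  h.isSubdivision.dim_le p h.mem_pieces

lemma isCell_newCell (h : IsStep B T C w S pieces σ z₀ p) (z : Fin n → Bool) :
    IsCell B C (σ.newCell z₀ p z) := by
  unfold State.newCell
  split_ifs
  · exact h.isCell
  · exact h.valid.isCell z

lemma newCell_typ_le (h : IsStep B T C w S pieces σ z₀ p) (z : Fin n → Bool) :
    (σ.newCell z₀ p z).typ ≤ (σ.cell z).typ := by
  unfold State.newCell
  split_ifs with hz
  · rw [← h.valid.cell_congr _ _ hz]; exact h.typ_lt.le
  · exact le_rfl

lemma preAvail_subset_avail (hz : ¬ Agree p.dim z₀ z) :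
    σ.preAvail pieces z₀ p z ⊆ σ.avail z := by
  unfold State.preAvail
  rw [if_neg hz]
  split_ifs
  · exact erase_subset _ _
  · exact subset_rfl

lemma preAvail_subset (h : IsStep B T C w S pieces σ z₀ p) (z : Fin n → Bool) :
    σ.preAvail pieces z₀ p z ⊆ pieces (σ.newCell z₀ p z) := by
  by_cases hz : Agree p.dim z₀ z
  · simp [State.preAvail, State.newCell, hz]
  · refine (preAvail_subset_avail hz).trans ?_
    simp only [State.newCell, hz, if_false]
    exact h.valid.avail_subset z

lemma preAvail_disjoint (h : IsStep B T C w S pieces σ z₀ p) (z : Fin n → Bool) :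
    (σ.preAvail pieces z₀ p z : Set (Cell V)).PairwiseDisjoint Cell.carrier :=
  (h.subdiv.disjoint (h.isCell_newCell z)).subset (by exact_mod_cast h.preAvail_subset z)

/-- If the two ends are already separated, this is the invariant. Otherwise they share a cell of
dimension d > i, and all pieces available at the other end have dimension at most `p.dim`, so the
degree bound of the subdivision applies. As `p.dim ≤ i`, the density is at most 2 ^ (i + 1 - d)
times a ratio of consecutive `C`, which the condition `degree` on the weights absorbs. -/
lemma edgeCount_piece_le (h : IsStep B T C w S pieces σ z₀ p) (hz : Agree p.dim z₀ z)
    (hi : p.dim ≤ (i : ℕ)) :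
    (edgeCount B p.carrier (support (σ.avail (flipAt z i))) : ℝ) ≤
      σ.wt z i ^ (p.typ + (σ.cell (flipAt z i)).typ + 1) *
        (#p.carrier * #(σ.cell (flipAt z i)).carrier) := by
  have hcell := h.valid.cell_congr _ _ hz
  have hmem : p ∈ σ.avail z := h.valid.avail_congr _ _ hz ▸ h.mem
  by_cases hsep : (σ.cell z).dim ≤ (i : ℕ) ∨ (σ.cell (flipAt z i)).dim ≤ (i : ℕ)
  · exact h.valid.sparse z i hsep p hmem
  push Not at hsep
  have hflip := h.valid.cell_flip z i hsep.1 hsep.2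
  rw [← hflip, h.valid.wt_eq z i hsep.1, ← hcell]
  rw [← hcell] at hflip hsep
  have hsub : σ.avail (flipAt z i) ⊆ {q ∈ pieces (σ.cell z₀) | q.dim ≤ p.dim} := by
    intro q hq
    rw [mem_filter]
    refine ⟨hflip ▸ h.valid.avail_subset _ hq, h.valid.avail_dim _ ?_ q hq⟩
    rw [← hflip]; exact h.typ_ne
  have hE : edgeCount B p.carrier (support (σ.avail (flipAt z i))) ≤
      #p.carrier * (C ((σ.cell z₀).typ - 1) * 2 ^ (p.dim + 1)) := by
    refine edgeCount_le_of_degree B fun v hv => ?_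
    refine (card_le_card (filter_subset_filter _ (support_mono hsub))).trans ?_
    exact h.isSubdivision.degree_le p h.mem_pieces (hi.trans_lt hsep.1) v hv
  obtain ⟨t, ht⟩ := Nat.exists_eq_succ_of_ne_zero h.typ_ne
  have htT := h.valid.typ_le z₀
  have hpt := h.typ_lt
  rw [(h.valid.isCell z₀).card_eq]
  set d := (σ.cell z₀).dim
  rw [ht] at hE htT hpt ⊢
  simp only [Nat.succ_eq_add_one, Nat.add_sub_cancel] at *
  have h1 : (C t : ℝ) * 2 ^ (p.dim + 1) ≤ w (d - i) ^ (p.typ + (t + 1) + 1) *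
      (C (t + 1) * 2 ^ d) := by
    calc (C t : ℝ) * 2 ^ (p.dim + 1) ≤ C t * 2 ^ ((i : ℕ) + 1) := by
          gcongr; norm_num
      _ = 2 * C t * 2 ^ (i : ℕ) := by ring
      _ ≤ w (d - i) ^ (2 * T) * C (t + 1) * 2 ^ (d - i) * 2 ^ (i : ℕ) := by
          exact mul_le_mul_of_nonneg_right (h.weight.degree t (d - i)) (by positivity)
      _ = w (d - i) ^ (2 * T) * (C (t + 1) * 2 ^ d) := by
          rw [mul_assoc, ← pow_add, Nat.sub_add_cancel hsep.1.le, mul_assoc]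
      _ ≤ _ := by
          refine mul_le_mul_of_nonneg_right ?_ (by positivity)
          -- The exponent is at most 2T because `p.typ ≤ t` and `t + 1 ≤ T`.
          exact pow_le_pow_of_le_one (h.weight.pos _).le (h.weight.lt_one _).le (by omega)
  calc (edgeCount B p.carrier (support (σ.avail (flipAt z i))) : ℝ)
      ≤ #p.carrier * (C t * 2 ^ (p.dim + 1)) := by exact_mod_cast hE
    _ ≤ #p.carrier * (w (d - i) ^ (p.typ + (t + 1) + 1) * (C (t + 1) * 2 ^ d)) := by gcongr
    _ = _ := by push_cast; ring

lemma edgeCount_crossing_le_of_agree (h : IsStep B T C w S pieces σ z₀ p)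
    (hz : Agree p.dim z₀ z) (hc : Crossing z₀ p.dim z i) :
    (edgeCount B (support (σ.preAvail pieces z₀ p z))
      (support (σ.preAvail pieces z₀ p (flipAt z i))) : ℝ) ≤
      σ.wt z i ^ ((σ.newCell z₀ p z).typ + (σ.newCell z₀ p (flipAt z i)).typ + 1) *
        (#(σ.newCell z₀ p z).carrier * #(σ.newCell z₀ p (flipAt z i)).carrier) := by
  have hz' := hc.1 hz
  have h1 : support (σ.preAvail pieces z₀ p z) = p.carrier := by
    simp [State.preAvail, hz, h.subdiv.support_eq h.isCell]
  have h2 : σ.newCell z₀ p z = p := by simp [State.newCell, hz]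
  have h3 : σ.newCell z₀ p (flipAt z i) = σ.cell (flipAt z i) := by simp [State.newCell, hz']
  rw [h1, h2, h3]
  refine le_trans ?_ (h.edgeCount_piece_le hz hc.le)
  exact_mod_cast edgeCount_mono B subset_rfl (support_mono (preAvail_subset_avail hz'))

lemma edgeCount_crossing_le (h : IsStep B T C w S pieces σ z₀ p) (hc : Crossing z₀ p.dim z i) :
    (edgeCount B (support (σ.preAvail pieces z₀ p z))
      (support (σ.preAvail pieces z₀ p (flipAt z i))) : ℝ) ≤
      σ.wt z i ^ ((σ.newCell z₀ p z).typ + (σ.newCell z₀ p (flipAt z i)).typ + 1) *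
        (#(σ.newCell z₀ p z).carrier * #(σ.newCell z₀ p (flipAt z i)).carrier) := by
  by_cases hz : Agree p.dim z₀ z
  · exact h.edgeCount_crossing_le_of_agree hz hc
  · have hz' : Agree p.dim z₀ (flipAt z i) := by
      unfold Crossing at hc; tauto
    have := h.edgeCount_crossing_le_of_agree hz' hc.flip
    rw [flipAt_flipAt, h.valid.wt_flip, edgeCount_comm] at this
    refine this.trans_eq ?_
    rw [add_comm (σ.newCell z₀ p z).typ, mul_comm (#(σ.newCell z₀ p z).carrier : ℝ)]

lemma card_newCell_pos (h : IsStep B T C w S pieces σ z₀ p) (z : Fin n → Bool) :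
    0 < #(σ.newCell z₀ p z).carrier := by
  rw [(h.isCell_newCell z).card_eq]
  have := h.weight.const_pos (σ.newCell z₀ p z).typ
  positivity

/-- A cell of type 0 is its own only piece, so the density bound for the whole cell is already the
one required of the piece. Final cells are therefore never discarded. -/
lemma good_of_typ_eq_zero (h : IsStep B T C w S pieces σ z₀ p)
    (ht : (σ.newCell z₀ p z).typ = 0) (hc : Crossing z₀ p.dim z i) {q : Cell V}
    (hq : q ∈ σ.preAvail pieces z₀ p z) : σ.Good B pieces z₀ p z q i := by
  have hq' := h.preAvail_subset z hq
  rw [h.subdiv.of_typ_eq _ ht, mem_singleton] at hq'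
  subst hq'
  refine le_trans ?_ (h.edgeCount_crossing_le hc)
  exact_mod_cast edgeCount_mono B (carrier_subset_support hq) subset_rfl

/-- Markov's inequality: a bad piece has smaller type than its cell, so its density exceeds the
average allowed for the cell by a factor of at least 1/ω, with ω the weight of the edge. -/
lemma sum_bad_le (h : IsStep B T C w S pieces σ z₀ p)
    (ht : (σ.newCell z₀ p z).typ ≠ 0) (hc : Crossing z₀ p.dim z i) :
    ∑ q ∈ σ.preAvail pieces z₀ p z with ¬ σ.Good B pieces z₀ p z q i, (#q.carrier : ℝ) ≤
      σ.wt z i * #(σ.newCell z₀ p z).carrier := by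
  set c := σ.newCell z₀ p z with hcdef
  set c' := σ.newCell z₀ p (flipAt z i) with hcdef'
  have hω := h.valid.wt_pos z i
  have hc'pos : (0 : ℝ) < #c'.carrier := by exact_mod_cast h.card_newCell_pos _
  have hτ : 0 < σ.wt z i ^ (c.typ + c'.typ) * #c'.carrier := by positivity
  have key := mul_sum_card_le B (h.preAvail_disjoint z)
    (filter_subset (fun q => ¬ σ.Good B pieces z₀ p z q i) _)
    (support (σ.preAvail pieces z₀ p (flipAt z i)))
    (τ := σ.wt z i ^ (c.typ + c'.typ) * #c'.carrier) ?_
  · have := key.trans (h.edgeCount_crossing_le hc)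
    rw [← hcdef, ← hcdef'] at this
    refine le_of_mul_le_mul_left (this.trans_eq ?_) hτ
    ring
  · intro q hq
    obtain ⟨hq, hbad⟩ := mem_filter.1 hq
    unfold State.Good at hbad
    rw [not_le, ← hcdef'] at hbad
    refine le_trans ?_ hbad.le
    have hlt := (h.subdiv.of_typ_ne c (h.isCell_newCell z) ht).typ_lt q (h.preAvail_subset z hq)
    calc σ.wt z i ^ (c.typ + c'.typ) * #c'.carrier * #q.carrier
        = σ.wt z i ^ (c.typ + c'.typ) * (#q.carrier * #c'.carrier) := by ring
      _ ≤ _ := by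
        refine mul_le_mul_of_nonneg_right ?_ (by positivity)
        exact pow_le_pow_of_le_one hω.le (h.valid.wt_lt_one z i).le (by omega)

lemma sum_preAvail_le (h : IsStep B T C w S pieces σ z₀ p)
    (ht : (σ.newCell z₀ p z).typ ≠ 0) :
    ∑ q ∈ σ.preAvail pieces z₀ p z, (#q.carrier : ℝ) ≤
      ∑ q ∈ (σ.refine B w pieces z₀ p).avail z, (#q.carrier : ℝ) +
        #(σ.newCell z₀ p z).carrier * ∑ i with Crossing z₀ p.dim z i, σ.wt z i := by
  have hsplit := sum_filter_add_sum_filter_not (σ.preAvail pieces z₀ p z)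
    (fun q => ∀ i, Crossing z₀ p.dim z i → σ.Good B pieces z₀ p z q i)
    (fun q => (#q.carrier : ℝ))
  rw [← hsplit]
  refine add_le_add le_rfl ?_
  calc ∑ q ∈ σ.preAvail pieces z₀ p z with
          ¬ ∀ i, Crossing z₀ p.dim z i → σ.Good B pieces z₀ p z q i, (#q.carrier : ℝ)
      ≤ ∑ q ∈ σ.preAvail pieces z₀ p z, ∑ i with Crossing z₀ p.dim z i,
          (if ¬ σ.Good B pieces z₀ p z q i then (#q.carrier : ℝ) else 0) := by
        rw [sum_filter]
        refine sum_le_sum fun q _ => ?_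
        by_cases hq : ∀ i, Crossing z₀ p.dim z i → σ.Good B pieces z₀ p z q i
        · rw [if_neg (not_not.2 hq)]
          exact sum_nonneg fun j _ => by split_ifs <;> positivity
        · rw [if_pos hq]
          push Not at hq
          obtain ⟨i, hi, hbad⟩ := hq
          refine le_trans ?_ (single_le_sum (f := fun i =>
            if ¬ σ.Good B pieces z₀ p z q i then (#q.carrier : ℝ) else 0)
            (fun j _ => by split_ifs <;> positivity)
            (mem_filter.2 ⟨mem_univ i, hi⟩))
          simp [hbad]
    _ = ∑ i with Crossing z₀ p.dim z i, ∑ q ∈ σ.preAvail pieces z₀ p z with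
          ¬ σ.Good B pieces z₀ p z q i, (#q.carrier : ℝ) := by
        rw [sum_comm]
        simp only [sum_filter]
    _ ≤ ∑ i with Crossing z₀ p.dim z i, σ.wt z i * #(σ.newCell z₀ p z).carrier :=
        sum_le_sum fun i hi => h.sum_bad_le ht (mem_filter.1 hi).2
    _ = _ := by rw [mul_sum]; exact sum_congr rfl fun i _ => mul_comm _ _

lemma newCell_of_agree (hz : Agree p.dim z₀ z) : σ.newCell z₀ p z = p := if_pos hz

lemma newCell_of_not_agree (hz : ¬ Agree p.dim z₀ z) : σ.newCell z₀ p z = σ.cell z := if_neg hz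

lemma preAvail_of_agree (hz : Agree p.dim z₀ z) : σ.preAvail pieces z₀ p z = pieces p := if_pos hz

lemma agree_congr {D : ℕ} {x y z : Fin n → Bool} (h : Agree D y z) :
    Agree D x y ↔ Agree D x z := ⟨fun h' => h'.trans h, fun h' => h'.trans h.symm⟩

lemma newCell_congr (h : IsStep B T C w S pieces σ z₀ p) {y z : Fin n → Bool}
    (hyz : Agree p.dim y z) : σ.newCell z₀ p y = σ.newCell z₀ p z := by
  simp only [State.newCell, agree_congr hyz, h.valid.cell_congr _ _ hyz]

lemma preAvail_congr (h : IsStep B T C w S pieces σ z₀ p) {y z : Fin n → Bool}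
    (hyz : Agree p.dim y z) : σ.preAvail pieces z₀ p y = σ.preAvail pieces z₀ p z := by
  simp only [State.preAvail, agree_congr hyz, h.valid.cell_congr _ _ hyz,
    h.valid.avail_congr _ _ hyz, agree_congr (hyz.mono h.dim_le_dim)]

lemma crossing_congr {D : ℕ} {y z : Fin n → Bool} (hyz : Agree D y z) (i : Fin n) :
    Crossing z₀ D y i ↔ Crossing z₀ D z i := by
  simp only [Crossing, agree_congr hyz, agree_congr (hyz.flipAt i)]

lemma good_congr (h : IsStep B T C w S pieces σ z₀ p) {y z : Fin n → Bool}
    (hyz : Agree p.dim y z) (q : Cell V) (i : Fin n) :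
    σ.Good B pieces z₀ p y q i ↔ σ.Good B pieces z₀ p z q i := by
  simp only [State.Good, h.newCell_congr (hyz.flipAt i), h.preAvail_congr (hyz.flipAt i),
    h.valid.wt_congr _ _ hyz]

lemma refine_avail_subset (z : Fin n → Bool) :
    (σ.refine B w pieces z₀ p).avail z ⊆ σ.preAvail pieces z₀ p z := filter_subset _ _

lemma sparse_refine (h : IsStep B T C w S pieces σ z₀ p)
    (hsep : (σ.newCell z₀ p z).dim ≤ (i : ℕ) ∨ (σ.newCell z₀ p (flipAt z i)).dim ≤ (i : ℕ))
    {q : Cell V} (hq : q ∈ (σ.refine B w pieces z₀ p).avail z) :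
    (edgeCount B q.carrier (support ((σ.refine B w pieces z₀ p).avail (flipAt z i))) : ℝ) ≤
      (σ.refine B w pieces z₀ p).wt z i ^ (q.typ + (σ.newCell z₀ p (flipAt z i)).typ + 1) *
        (#q.carrier * #(σ.newCell z₀ p (flipAt z i)).carrier) := by
  by_cases hc : Crossing z₀ p.dim z i
  · have hwt : (σ.refine B w pieces z₀ p).wt z i = σ.wt z i :=
      if_neg fun hh => absurd hc.le (not_le.2 hh.2)
    rw [hwt]
    refine le_trans ?_ ((mem_filter.1 hq).2 i hc)
    exact_mod_cast edgeCount_mono B subset_rfl (support_mono (refine_avail_subset _))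
  · by_cases hz : Agree p.dim z₀ z
    · have hz' : Agree p.dim z₀ (flipAt z i) := by
        unfold Crossing at hc; tauto
      rw [newCell_of_agree hz, newCell_of_agree hz', or_self] at hsep
      exact absurd (hz.symm.trans hz') (not_agree_flipAt z hsep)
    · have hz' : ¬ Agree p.dim z₀ (flipAt z i) := by
        unfold Crossing at hc; tauto
      have hwt : (σ.refine B w pieces z₀ p).wt z i = σ.wt z i := if_neg fun hh => hz hh.1
      rw [newCell_of_not_agree hz, newCell_of_not_agree hz'] at hsep
      rw [hwt, newCell_of_not_agree hz']
      refine le_trans ?_ (h.valid.sparse z i hsep q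
        (preAvail_subset_avail hz (refine_avail_subset _ hq)))
      exact_mod_cast edgeCount_mono B subset_rfl
        (support_mono ((refine_avail_subset _).trans (preAvail_subset_avail hz')))

lemma one_le_sub_typ (h : IsStep B T C w S pieces σ z₀ p) (z : Fin n → Bool) :
    (1 : ℝ) ≤ T + 1 - (σ.newCell z₀ p z).typ := by
  have h1 : (σ.newCell z₀ p z).typ ≤ T := (h.newCell_typ_le z).trans (h.valid.typ_le z)
  have h2 : ((σ.newCell z₀ p z).typ : ℝ) ≤ T := by exact_mod_cast h1
  linarith

lemma refine_wt_pos (h : IsStep B T C w S pieces σ z₀ p) (z : Fin n → Bool) (i : Fin n) :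
    0 < (σ.refine B w pieces z₀ p).wt z i := by
  simp only [State.refine]
  split_ifs
  · exact h.weight.pos _
  · exact h.valid.wt_pos z i

lemma budget_of_agree (h : IsStep B T C w S pieces σ z₀ p) (hz : Agree p.dim z₀ z)
    (ht : (σ.newCell z₀ p z).typ ≠ 0) :
    (#(σ.newCell z₀ p z).carrier : ℝ) ≤
      ∑ q ∈ (σ.refine B w pieces z₀ p).avail z, (#q.carrier : ℝ) +
        #(σ.newCell z₀ p z).carrier * ∑ i, (T + 1 - (σ.newCell z₀ p (flipAt z i)).typ) *
          (σ.refine B w pieces z₀ p).wt z i := by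
  have hsum : (#(σ.newCell z₀ p z).carrier : ℝ) =
      ∑ q ∈ σ.preAvail pieces z₀ p z, (#q.carrier : ℝ) := by
    rw [newCell_of_agree hz, preAvail_of_agree hz, ← h.subdiv.support_eq h.isCell, support,
      card_biUnion (h.subdiv.disjoint h.isCell)]
    push_cast; rfl
  conv_lhs => rw [hsum]
  refine (h.sum_preAvail_le ht).trans ?_
  gcongr
  rw [sum_filter]
  refine sum_le_sum fun i _ => ?_
  have h1 := h.one_le_sub_typ (flipAt z i)
  have h2 := h.refine_wt_pos z i
  split_ifs with hc
  · have hwt : (σ.refine B w pieces z₀ p).wt z i = σ.wt z i :=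
      if_neg fun hh => absurd hc.le (not_le.2 hh.2)
    rw [hwt] at h2 ⊢
    nlinarith
  · positivity

lemma budget_of_not_agree (h : IsStep B T C w S pieces σ z₀ p) (hz : ¬ Agree p.dim z₀ z)
    (ht : (σ.newCell z₀ p z).typ ≠ 0) :
    (#(σ.newCell z₀ p z).carrier : ℝ) ≤
      ∑ q ∈ (σ.refine B w pieces z₀ p).avail z, (#q.carrier : ℝ) +
        C ((σ.newCell z₀ p z).typ - 1) * #{y | Agree (σ.newCell z₀ p z).dim z y ∧
          (σ.newCell z₀ p y).typ < (σ.newCell z₀ p z).typ} +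
        #(σ.newCell z₀ p z).carrier * ∑ i, (T + 1 - (σ.newCell z₀ p (flipAt z i)).typ) *
          (σ.refine B w pieces z₀ p).wt z i := by
  have hcross := h.sum_preAvail_le ht
  have hnew := newCell_of_not_agree (σ := σ) hz
  rw [hnew] at hcross ht ⊢
  have hwt : ∀ i, (σ.refine B w pieces z₀ p).wt z i = σ.wt z i :=
    fun i => if_neg fun hh => hz hh.1
  simp only [hwt]
  have hold := h.valid.budget z ht
  set old : Finset (Fin n → Bool) :=
    {y | Agree (σ.cell z).dim z y ∧ (σ.cell y).typ < (σ.cell z).typ} with hold_def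
  set new : Finset (Fin n → Bool) :=
    {y | Agree (σ.cell z).dim z y ∧ (σ.newCell z₀ p y).typ < (σ.cell z).typ} with hnew_def
  have hon : old ⊆ new := by
    intro y hy
    have hy := (mem_filter.1 hy).2
    exact mem_filter.2 ⟨mem_univ _, hy.1, (h.newCell_typ_le y).trans_lt hy.2⟩
  -- Across each crossing direction the type of the neighbour drops by at least 1, which pays for
  -- the pieces discarded there.
  have hweights : ∑ i, (T + 1 - ((σ.cell (flipAt z i)).typ : ℝ)) * σ.wt z i +
      ∑ i with Crossing z₀ p.dim z i, σ.wt z i ≤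
      ∑ i, (T + 1 - ((σ.newCell z₀ p (flipAt z i)).typ : ℝ)) * σ.wt z i := by
    rw [sum_filter, ← sum_add_distrib]
    refine sum_le_sum fun i _ => ?_
    have hω := h.valid.wt_pos z i
    split_ifs with hc
    · have hz' : Agree p.dim z₀ (flipAt z i) := by
        unfold Crossing at hc; tauto
      have hlt := h.typ_lt
      rw [h.valid.cell_congr _ _ hz'] at hlt
      have hlt' : (p.typ : ℝ) + 1 ≤ (σ.cell (flipAt z i)).typ := by exact_mod_cast hlt
      rw [newCell_of_agree hz']
      nlinarith
    · have hle : ((σ.newCell z₀ p (flipAt z i)).typ : ℝ) ≤ (σ.cell (flipAt z i)).typ := by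
        exact_mod_cast h.newCell_typ_le _
      nlinarith
  have hpieces : ∑ q ∈ σ.avail z, (#q.carrier : ℝ) + C ((σ.cell z).typ - 1) * #old ≤
      ∑ q ∈ σ.preAvail pieces z₀ p z, (#q.carrier : ℝ) + C ((σ.cell z).typ - 1) * #new := by
    by_cases hcond : σ.cell z = σ.cell z₀ ∧ Agree (σ.cell z₀).dim z₀ z
    · have hpre : σ.preAvail pieces z₀ p z = (σ.avail z).erase p := by
        unfold State.preAvail
        rw [if_neg hz, if_pos hcond]
      have h1 : ∑ q ∈ σ.avail z, (#q.carrier : ℝ) ≤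
          ∑ q ∈ (σ.avail z).erase p, (#q.carrier : ℝ) + #p.carrier := by
        by_cases hp : p ∈ σ.avail z
        · rw [sum_erase_add _ _ hp]
        · rw [erase_eq_of_notMem hp]
          have : (0 : ℝ) ≤ #p.carrier := by positivity
          linarith
      have h2 : (#p.carrier : ℝ) ≤ C ((σ.cell z).typ - 1) * 2 ^ p.dim := by
        rw [h.isCell.card_eq]
        push_cast
        gcongr
        refine h.weight.const_mono ?_
        have := h.typ_lt
        rw [hcond.1]; omega
      -- All points of the moving subcube are newly counted; there are exactly 2 ^ `p.dim` of them
      -- because `p.dim ≤ n`. They pay for the loss of `p`.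
      have h3 : #old + 2 ^ p.dim ≤ #new := by
        have hcard := card_agree p.dim z₀
        rw [min_eq_right h.dim_le] at hcard
        rw [← hcard, ← card_union_of_disjoint]
        · refine card_le_card (union_subset hon fun y hy => ?_)
          have hy := (mem_filter.1 hy).2
          refine mem_filter.2 ⟨mem_univ _, ?_, ?_⟩
          · rw [hcond.1]
            exact hcond.2.symm.trans (hy.mono h.dim_le_dim)
          · rw [newCell_of_agree hy, hcond.1]; exact h.typ_lt
        · rw [disjoint_left]
          intro y hy hy'
          have hy := (mem_filter.1 hy).2.2
          rw [← h.valid.cell_congr _ _ (mem_filter.1 hy').2, hcond.1] at hy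
          exact lt_irrefl _ hy
      have h3' : (#old : ℝ) + 2 ^ p.dim ≤ #new := by exact_mod_cast h3
      have hC0 : (0 : ℝ) ≤ C ((σ.cell z).typ - 1) := by positivity
      rw [hpre]
      nlinarith [mul_le_mul_of_nonneg_left h3' hC0]
    · have hpre : σ.preAvail pieces z₀ p z = σ.avail z := by
        unfold State.preAvail
        rw [if_neg hz, if_neg hcond]
      rw [hpre]
      gcongr
  have hmul := mul_le_mul_of_nonneg_left hweights
    (by positivity : (0 : ℝ) ≤ #(σ.cell z).carrier)
  rw [mul_add] at hmul
  linarith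

lemma disjoint_of_agree (h : IsStep B T C w S pieces σ z₀ p) {y z : Fin n → Bool}
    (hy : Agree p.dim z₀ y) (hz : ¬ Agree p.dim z₀ z) :
    Disjoint (support (σ.preAvail pieces z₀ p y)) (support (σ.preAvail pieces z₀ p z)) := by
  have h1 : support (σ.preAvail pieces z₀ p y) = p.carrier := by
    rw [preAvail_of_agree hy, h.subdiv.support_eq h.isCell]
  rw [h1]
  by_cases hcond : σ.cell z = σ.cell z₀ ∧ Agree (σ.cell z₀).dim z₀ z
  · unfold State.preAvail
    rw [if_neg hz, if_pos hcond, support, disjoint_biUnion_right]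
    intro q hq
    obtain ⟨hqp, hq⟩ := mem_erase.1 hq
    refine h.isSubdivision.disjoint (mem_coe.2 h.mem_pieces) (mem_coe.2 ?_) hqp.symm
    rw [← hcond.1]
    exact h.valid.avail_subset z hq
  · refine Disjoint.mono (carrier_subset_support h.mem)
      (support_mono (preAvail_subset_avail hz)) ?_
    refine (h.valid.disjoint z₀ z).resolve_left fun hh => hcond ⟨hh.1.symm, hh.2⟩

/-- A move replaces only weights in directions below `p.dim`; the new ones add at most `S`, and the
type drops by at least 1. -/
lemma wt_sum_refine (h : IsStep B T C w S pieces σ z₀ p) (z : Fin n → Bool) :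
    ∑ i, (σ.refine B w pieces z₀ p).wt z i ≤ (T + 1 - (σ.newCell z₀ p z).typ) * S := by
  by_cases hz : Agree p.dim z₀ z
  · have hlt := h.typ_lt
    rw [h.valid.cell_congr _ _ hz] at hlt
    have hlt' : (p.typ : ℝ) + 1 ≤ (σ.cell z).typ := by exact_mod_cast hlt
    rw [newCell_of_agree hz]
    calc ∑ i, (σ.refine B w pieces z₀ p).wt z i
        ≤ ∑ i : Fin n, ((if (i : ℕ) < p.dim then w (p.dim - i) else 0) + σ.wt z i) := by
          refine sum_le_sum fun i _ => ?_
          have := h.valid.wt_pos z i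
          simp only [State.refine, hz, true_and]
          split_ifs <;> linarith
      _ ≤ S + (T + 1 - (σ.cell z).typ) * S := by
          rw [sum_add_distrib]
          exact add_le_add (h.weight.sum_fin_le n p.dim) (h.valid.wt_sum z)
      _ ≤ _ := by nlinarith [h.weight.sum_nonneg]
  · have hwt : ∀ i, (σ.refine B w pieces z₀ p).wt z i = σ.wt z i :=
      fun i => if_neg fun hh => hz hh.1
    simp only [hwt, newCell_of_not_agree hz]
    exact h.valid.wt_sum z

lemma valid_refine (h : IsStep B T C w S pieces σ z₀ p) :
    Valid B T C w S pieces p.dim (σ.refine B w pieces z₀ p) where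
  isCell := h.isCell_newCell
  typ_le z := (h.newCell_typ_le z).trans (h.valid.typ_le z)
  avail_subset z := (refine_avail_subset z).trans (h.preAvail_subset z)
  avail_eq z ht := by
    have hpre : σ.preAvail pieces z₀ p z = {σ.newCell z₀ p z} := by
      by_cases hz : Agree p.dim z₀ z
      · rw [newCell_of_agree hz, preAvail_of_agree hz]
        refine h.subdiv.of_typ_eq p ?_
        rw [← newCell_of_agree (σ := σ) hz]; exact ht
      · have hcell := newCell_of_not_agree (σ := σ) hz
        change (σ.newCell z₀ p z).typ = 0 at ht
        rw [hcell] at ht ⊢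
        unfold State.preAvail
        rw [if_neg hz, if_neg, h.valid.avail_eq z ht]
        rintro ⟨hc, -⟩
        exact h.typ_ne (hc ▸ ht)
    change (σ.preAvail pieces z₀ p z).filter _ = {σ.newCell z₀ p z}
    rw [filter_true_of_mem fun q hq i hc => h.good_of_typ_eq_zero ht hc hq, hpre]
  avail_dim z ht q hq := by
    have hq' := refine_avail_subset z hq
    by_cases hz : Agree p.dim z₀ z
    · rw [preAvail_of_agree hz] at hq'
      exact h.subdiv.dim_le h.isCell hq'
    · change (σ.newCell z₀ p z).typ ≠ 0 at ht
      rw [newCell_of_not_agree hz] at ht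
      exact h.valid.avail_dim z ht q (preAvail_subset_avail hz hq')
  cell_congr y z hyz := h.newCell_congr hyz
  avail_congr y z hyz := by
    simp only [State.refine, h.preAvail_congr hyz, crossing_congr hyz, h.good_congr hyz]
  wt_congr y z hyz := by
    simp only [State.refine, agree_congr hyz, h.valid.wt_congr _ _ hyz]
  wt_flip z i := by
    by_cases hi : (i : ℕ) < p.dim
    · simp only [State.refine, agree_flipAt_iff z₀ z hi, h.valid.wt_flip]
    · simp only [State.refine, hi, and_false, if_false, h.valid.wt_flip]
  wt_pos := h.refine_wt_pos
  wt_lt_one z i := by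
    simp only [State.refine]
    split_ifs
    · exact h.weight.lt_one _
    · exact h.valid.wt_lt_one z i
  wt_eq z i hi := by
    change (i : ℕ) < (σ.newCell z₀ p z).dim at hi
    change _ = w ((σ.newCell z₀ p z).dim - i)
    by_cases hz : Agree p.dim z₀ z
    · rw [newCell_of_agree hz] at hi ⊢
      exact if_pos ⟨hz, hi⟩
    · rw [newCell_of_not_agree hz] at hi ⊢
      rw [← h.valid.wt_eq z i hi]
      exact if_neg fun hh => hz hh.1
  wt_sum := h.wt_sum_refine
  cell_flip z i hi hi' := by
    change (i : ℕ) < (σ.newCell z₀ p z).dim at hi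
    change (i : ℕ) < (σ.newCell z₀ p (flipAt z i)).dim at hi'
    change σ.newCell z₀ p z = σ.newCell z₀ p (flipAt z i)
    by_cases hip : (i : ℕ) < p.dim
    · exact h.newCell_congr (agree_flipAt z hip)
    · have hz : ¬ Agree p.dim z₀ z := fun hz => hip (by rwa [newCell_of_agree hz] at hi)
      have hz' : ¬ Agree p.dim z₀ (flipAt z i) :=
        fun hz => hip (by rwa [newCell_of_agree hz] at hi')
      rw [newCell_of_not_agree hz] at hi ⊢
      rw [newCell_of_not_agree hz'] at hi' ⊢
      exact h.valid.cell_flip z i hi hi'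
  sparse z i hsep q hq := h.sparse_refine hsep hq
  budget z ht := by
    by_cases hz : Agree p.dim z₀ z
    · refine (h.budget_of_agree hz ht).trans ?_
      refine add_le_add (le_add_of_nonneg_right (by positivity)) le_rfl
    · exact h.budget_of_not_agree hz ht
  disjoint y z := by
    change (σ.newCell z₀ p y = σ.newCell z₀ p z ∧ Agree (σ.newCell z₀ p y).dim y z) ∨ _
    by_cases hy : Agree p.dim z₀ y <;> by_cases hz : Agree p.dim z₀ z
    · left
      rw [newCell_of_agree hy, newCell_of_agree hz]
      exact ⟨rfl, hy.symm.trans hz⟩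
    · right
      exact (h.disjoint_of_agree hy hz).mono (support_mono (refine_avail_subset _))
        (support_mono (refine_avail_subset _))
    · right
      exact ((h.disjoint_of_agree hz hy).mono (support_mono (refine_avail_subset _))
        (support_mono (refine_avail_subset _))).symm
    · rw [newCell_of_not_agree hy, newCell_of_not_agree hz]
      refine (h.valid.disjoint y z).imp_right fun hd => ?_
      exact hd.mono (support_mono ((refine_avail_subset _).trans (preAvail_subset_avail hy)))
        (support_mono ((refine_avail_subset _).trans (preAvail_subset_avail hz)))

lemma sum_typ_lt (h : IsStep B T C w S pieces σ z₀ p) :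
    ∑ z, ((σ.refine B w pieces z₀ p).cell z).typ < ∑ z, (σ.cell z).typ := by
  refine sum_lt_sum (fun z _ => h.newCell_typ_le z) ⟨z₀, mem_univ _, ?_⟩
  change (σ.newCell z₀ p z₀).typ < _
  rw [newCell_of_agree (Agree.refl _ _)]
  exact h.typ_lt

end IsStep

/-! ### Running the process through all dimensions, and reading off the embedding. -/

/-- Moving subcubes for as long as possible uses up all available pieces of dimension `D`. -/
lemma Valid.exists_exhausted (hw : IsWeight T C w S) (hp : IsSubdivisionMap B C pieces)
    (hD : D ≤ n) (hσ : Valid B T C w S pieces D σ) :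
    ∃ σ' : State n V, Valid B T C w S pieces D σ' ∧
      ∀ z, (σ'.cell z).typ ≠ 0 → ∀ q ∈ σ'.avail z, q.dim < D := by
  -- Each move lowers the sum of all types, although it may create new pieces of dimension D.
  induction hm : ∑ z, (σ.cell z).typ using Nat.strong_induction_on generalizing σ with
  | _ m ih =>
  by_cases hex : ∃ z, (σ.cell z).typ ≠ 0 ∧ ∃ q ∈ σ.avail z, q.dim = D
  · obtain ⟨z, hz, q, hq, rfl⟩ := hex
    have hstep : IsStep B T C w S pieces σ z q := ⟨hw, hp, hσ, hD, hz, hq⟩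
    exact ih _ (hm ▸ hstep.sum_typ_lt) hstep.valid_refine rfl
  · push Not at hex
    exact ⟨σ, hσ, fun z hz q hq => lt_of_le_of_ne (hσ.avail_dim z hz q hq) (hex z hz q hq)⟩

lemma Valid.of_lt {E : ℕ} (hσ : Valid B T C w S pieces E σ) (hDE : D ≤ E)
    (h : ∀ z, (σ.cell z).typ ≠ 0 → ∀ q ∈ σ.avail z, q.dim ≤ D) : Valid B T C w S pieces D σ :=
  { hσ with
    avail_dim := h
    cell_congr := fun y z hyz => hσ.cell_congr y z (hyz.mono hDE)
    avail_congr := fun y z hyz => hσ.avail_congr y z (hyz.mono hDE)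
    wt_congr := fun y z hyz => hσ.wt_congr y z (hyz.mono hDE) }

lemma Valid.exists_zero (hw : IsWeight T C w S) (hp : IsSubdivisionMap B C pieces)
    (hD : D ≤ n) (hσ : Valid B T C w S pieces D σ) :
    ∃ σ' : State n V, Valid B T C w S pieces 0 σ' ∧
      ∀ z, (σ'.cell z).typ ≠ 0 → σ'.avail z = ∅ := by
  induction D generalizing σ with
  | zero =>
    obtain ⟨σ', h1, h2⟩ := hσ.exists_exhausted hw hp hD
    refine ⟨σ', h1, fun z hz => eq_empty_of_forall_notMem fun q hq => ?_⟩
    exact absurd (h2 z hz q hq) (Nat.not_lt_zero _)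
  | succ D ih =>
    obtain ⟨σ', h1, h2⟩ := hσ.exists_exhausted hw hp hD
    exact ih (by omega) (h1.of_lt (Nat.le_succ D) fun z hz q hq => Nat.le_of_lt_succ (h2 z hz q hq))

/-- The budget forces every point to end in a cell of type `0`. -/
lemma Valid.typ_eq_zero (hw : IsWeight T C w S) (hσ : Valid B T C w S pieces D σ)
    (h : ∀ z, (σ.cell z).typ ≠ 0 → σ.avail z = ∅) (z : Fin n → Bool) : (σ.cell z).typ = 0 := by
  by_contra ht
  have hb := hσ.budget z ht
  rw [h z ht, sum_empty, zero_add] at hb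
  set c := σ.cell z
  obtain ⟨t, ht'⟩ := Nat.exists_eq_succ_of_ne_zero ht
  have hcard := (hσ.isCell z).card_eq
  have hcube : #{y | Agree c.dim z y ∧ (σ.cell y).typ < c.typ} ≤ 2 ^ c.dim := by
    calc _ ≤ #{y | Agree c.dim z y} := card_le_card fun y hy =>
          mem_filter.2 ⟨mem_univ _, (mem_filter.1 hy).2.1⟩
      _ = 2 ^ min n c.dim := card_agree _ _
      _ ≤ _ := Nat.pow_le_pow_right two_pos (min_le_right _ _)
  have hsum : ∑ i, (T + 1 - ((σ.cell (flipAt z i)).typ : ℝ)) * σ.wt z i ≤ 1 / 4 := by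
    calc _ ≤ ∑ i, ((T : ℝ) + 1) * σ.wt z i := by
          refine sum_le_sum fun i _ => mul_le_mul_of_nonneg_right ?_ (hσ.wt_pos z i).le
          have : (0 : ℝ) ≤ (σ.cell (flipAt z i)).typ := by positivity
          linarith
      _ ≤ ((T : ℝ) + 1) * ((T + 1 - c.typ) * S) := by
          rw [← mul_sum]
          exact mul_le_mul_of_nonneg_left (hσ.wt_sum z) (by positivity)
      _ ≤ ((T : ℝ) + 1) * ((T + 1) * S) := by
          have h1 : (0 : ℝ) ≤ c.typ := by positivity
          have := hw.sum_nonneg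
          gcongr
          linarith
      _ ≤ 1 / 4 := by nlinarith [hw.small]
  have hpos : (0 : ℝ) < #c.carrier := by
    rw [hcard]
    have := hw.const_pos c.typ
    positivity
  -- At most half of the cell is used up, since `C` at least doubles from each type to the next.
  have h1 : (C (c.typ - 1) : ℝ) * #{y | Agree c.dim z y ∧ (σ.cell y).typ < c.typ} ≤
      #c.carrier / 2 := by
    calc _ ≤ (C (c.typ - 1) : ℝ) * 2 ^ c.dim := by
          gcongr; exact_mod_cast hcube
      _ ≤ _ := by
          rw [hcard, ht', Nat.succ_eq_add_one, Nat.add_sub_cancel]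
          have : (2 * C t : ℝ) ≤ C (t + 1) := by exact_mod_cast hw.two_mul_le t
          push_cast
          have h2 : (0 : ℝ) < 2 ^ c.dim := by positivity
          nlinarith
  nlinarith

/-- When all cells have type `0`, the state is an embedding of the cube. -/
lemma Valid.exists_embedding (hw : IsWeight T C w S) (hσ : Valid B T C w S pieces D σ)
    (h : ∀ z, (σ.cell z).typ = 0) :
    ∃ f : (Fin n → Bool) → V, Function.Injective f ∧
      ∀ y z, (hypercube n).Adj y z → ¬ B.Adj (f y) (f z) := by
  have hdim : ∀ z, (σ.cell z).dim = 0 := fun z => (hσ.isCell z).dim_eq (h z)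
  have hone : ∀ z, #(σ.cell z).carrier = 1 := fun z => by
    rw [(hσ.isCell z).card_eq, h z, hdim z, hw.zero_eq, pow_zero, mul_one]
  choose f hf using fun z => card_eq_one.1 (hone z)
  have hsupp : ∀ z, support (σ.avail z) = {f z} := fun z => by
    rw [hσ.avail_eq z (h z), support, singleton_biUnion, hf]
  refine ⟨f, fun y z hyz => ?_, fun y z hyz hadj => ?_⟩
  · obtain ⟨-, hag⟩ | hd := hσ.disjoint y z
    · funext i
      exact hag i (by rw [hdim]; exact Nat.zero_le _)
    · rw [hsupp, hsupp, hyz] at hd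
      simp at hd
  · obtain ⟨i, rfl⟩ := (hypercube_adj_iff y z).1 hyz
    -- With both types 0 the exponent is 1, so fewer than one edge of `B` joins the two single
    -- vertices.
    have hs := hσ.sparse y i (Or.inl (by rw [hdim]; exact Nat.zero_le _)) (σ.cell y)
      (by rw [hσ.avail_eq y (h y)]; exact mem_singleton_self _)
    rw [hsupp, hone, hone, hf, h, h] at hs
    have hlt := hσ.wt_lt_one y i
    have hmem : (f y, f (flipAt y i)) ∈ B.interedges {f y} {f (flipAt y i)} := by
      rw [SimpleGraph.mem_interedges_iff]
      simpa using hadj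
    have hpos : 1 ≤ edgeCount B {f y} {f (flipAt y i)} := card_pos.2 ⟨_, hmem⟩
    have hpos' : (1 : ℝ) ≤ edgeCount B {f y} {f (flipAt y i)} := by exact_mod_cast hpos
    norm_num at hs
    linarith

/-- A graph without `T`-cliques on `C T * 2 ^ n` vertices has the cube in its complement. -/
theorem exists_hypercube_of_cliqueFree [Fintype V] (hw : IsWeight T C w S) (hT : T ≠ 0)
    (hV : Fintype.card V = C T * 2 ^ n) (hB : B.CliqueFree T) :
    ∃ f : (Fin n → Bool) → V, Function.Injective f ∧
      ∀ y z, (hypercube n).Adj y z → ¬ B.Adj (f y) (f z) := by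
  have hex : ∀ c : Cell V, ∃ P : Finset (Cell V),
      (IsCell B C c → c.typ ≠ 0 → IsSubdivision B C c P) ∧ (c.typ = 0 → P = {c}) := by
    intro c
    by_cases ht : c.typ = 0
    · exact ⟨{c}, fun _ h => absurd ht h, fun _ => rfl⟩
    by_cases hc : IsCell B C c
    · obtain ⟨P, hP⟩ := exists_isSubdivision B hw.const_pos hw.zero_eq hc ht
      exact ⟨P, fun _ _ => hP, fun h => absurd h ht⟩
    · exact ⟨∅, fun h => absurd h hc, fun h => absurd h ht⟩
  choose pieces hpieces using hex
  have hp : IsSubdivisionMap B C pieces :=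
    ⟨fun c => (hpieces c).1, fun c => (hpieces c).2⟩
  set root : Cell V := ⟨univ, T, n⟩ with hroot
  have hcell : IsCell B C root :=
    ⟨by rw [hroot]; simpa using hV, fun h => absurd h hT, fun _ => hB.cliqueFreeOn⟩
  set σ : State n V := ⟨fun _ => root, fun _ => pieces root, fun _ i => w (n - i)⟩ with hσdef
  have hσ : Valid B T C w S pieces n σ :=
    { isCell := fun _ => hcell
      typ_le := fun _ => le_rfl
      avail_subset := fun _ => subset_rfl
      avail_eq := fun _ h => absurd h hT
      avail_dim := fun _ _ q hq => hp.dim_le hcell hq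
      cell_congr := fun _ _ _ => rfl
      avail_congr := fun _ _ _ => rfl
      wt_congr := fun _ _ _ => rfl
      wt_flip := fun _ _ => rfl
      wt_pos := fun _ _ => hw.pos _
      wt_lt_one := fun _ _ => hw.lt_one _
      wt_eq := fun _ _ _ => rfl
      wt_sum := fun z => by
        have := hw.sum_fin_le n n
        simp only [Fin.is_lt, if_true] at this
        refine this.trans_eq ?_
        simp [hσdef, hroot]
      cell_flip := fun _ _ _ _ => rfl
      -- Vacuous: initially no neighbours are separated, as every cell has dimension n > i.
      sparse := fun z i hi => by
        have := i.is_lt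
        simp only [hσdef, hroot, or_self] at hi
        omega
      budget := fun z _ => by
        have hsum : (#root.carrier : ℝ) = ∑ q ∈ pieces root, (#q.carrier : ℝ) := by
          rw [← hp.support_eq hcell, support, card_biUnion (hp.disjoint hcell)]
          push_cast; rfl
        simp only [hσdef]
        conv_lhs => rw [hsum]
        rw [add_assoc]
        refine le_add_of_nonneg_right (add_nonneg (by positivity)
          (mul_nonneg (by positivity) (sum_nonneg fun i _ => ?_)))
        refine mul_nonneg ?_ (hw.pos _).le
        simp [hroot]
      disjoint := fun y z => Or.inl ⟨rfl, fun i hi => absurd hi (not_le.2 i.is_lt)⟩ }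
  obtain ⟨σ', h1, h2⟩ := hσ.exists_zero hw hp le_rfl
  exact h1.exists_embedding hw (h1.typ_eq_zero hw h2)

end Embedding

/-! ### Choice of the size factors and weights. -/

section Constants

open Finset

/-- Geometric weights of ratio `1 - 1 / (4 T)` satisfy all numerical conditions. -/
lemma exists_isWeight {T : ℕ} (hT : T ≠ 0) :
    ∃ (C : ℕ → ℕ) (w : ℕ → ℝ) (S : ℝ), IsWeight T C w S := by
  have hT1 : (1 : ℝ) ≤ T := by exact_mod_cast Nat.one_le_iff_ne_zero.2 hT
  -- The powers of r sum to at most 4T, so S = 4T / K, and this K makes `small` an equality.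
  set K : ℕ := 16 * T * (T + 1) ^ 2 with hK
  have hK1 : 1 ≤ K := Nat.one_le_iff_ne_zero.2 (by positivity)
  have hK2 : (1 : ℝ) < K := by rw [hK]; push_cast; nlinarith [sq_nonneg (T : ℝ)]
  set r : ℝ := 1 - 1 / (4 * T) with hr
  have hq : 1 / (4 * (T : ℝ)) ≤ 1 / 4 := by
    rw [div_le_div_iff₀ (by positivity) (by norm_num)]; linarith
  have hq0 : 0 < 1 / (4 * (T : ℝ)) := by positivity
  have hr0 : 0 < r := by linarith
  have hr1 : r < 1 := by linarith
  -- Bernoulli's inequality; then (2 r ^ (2T)) ^ m ≥ 1, so the gain 2 ^ m in `degree` outweighs the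
  -- decay of the weights.
  have hbern : 1 / 2 ≤ r ^ (2 * T) := by
    have := one_add_mul_le_pow (a := -(1 / (4 * (T : ℝ)))) (by linarith) (2 * T)
    have h2 : (1 : ℝ) + (2 * T : ℕ) * -(1 / (4 * T)) = 1 / 2 := by
      push_cast; field_simp; norm_num
    rw [h2] at this
    rwa [hr, sub_eq_add_neg]
  have hle : ∀ m, r ^ m / K < 1 := fun m => by
    rw [div_lt_one (by linarith)]
    exact (pow_le_one₀ hr0.le hr1.le).trans_lt hK2
  refine ⟨fun t => (2 * K ^ (2 * T)) ^ t, fun m => r ^ m / K, 4 * T / K, ?_⟩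
  refine ⟨pow_zero _, fun t => ?_, fun m => by positivity, hle, fun t m => ?_,
    fun D => ?_, ?_⟩
  · rw [pow_succ, mul_comm]
    refine Nat.mul_le_mul_left _ ?_
    have := Nat.one_le_pow (2 * T) K hK1
    omega
  · have hK0 : (K : ℝ) ≠ 0 := by linarith
    have h1 : 1 ≤ (r ^ m) ^ (2 * T) * 2 ^ m := by
      rw [← pow_mul, mul_comm m, pow_mul, ← mul_pow]
      refine one_le_pow₀ ?_
      linarith
    push_cast
    rw [div_pow, pow_succ]
    have : (r ^ m) ^ (2 * T) / (K : ℝ) ^ (2 * T) *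
        ((2 * (K : ℝ) ^ (2 * T)) ^ t * (2 * (K : ℝ) ^ (2 * T))) * 2 ^ m =
        2 * (2 * (K : ℝ) ^ (2 * T)) ^ t * ((r ^ m) ^ (2 * T) * 2 ^ m) := by
      field_simp
    rw [this]
    exact le_mul_of_one_le_right (by positivity) h1
  · rw [← sum_div]
    gcongr
    have h1 : ∑ i ∈ range D, r ^ (D - i) ≤ ∑ i ∈ range D, r ^ i := by
      rw [← sum_range_reflect]
      refine sum_le_sum fun i hi => ?_
      have := mem_range.1 hi
      exact pow_le_pow_of_le_one hr0.le hr1.le (by omega)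
    refine h1.trans ?_
    have h2 := geom_sum_mul_neg r D
    have h3 : 1 - r = 1 / (4 * T) := by rw [hr]; ring
    rw [h3] at h2
    have h4 : (∑ i ∈ range D, r ^ i) = 4 * T * (1 - r ^ D) := by
      rw [← h2]; field_simp
    rw [h4]
    have : 0 < r ^ D := by positivity
    nlinarith
  · rw [hK]; push_cast
    field_simp
    norm_num

end Constants

/-- The `IsLeast` clause ensures that the infimum is attained and is not the default value 0 of
`sInf` on the empty set. -/
theorem theorem1 (s : ℕ) (hs : 3 ≤ s) :
    ∃ c : ℝ, ∀ n : ℕ,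
      IsLeast {N : ℕ | RamseyProperty (hypercube n) (⊤ : SimpleGraph (Fin s)) N}
        (ramseyNumber (hypercube n) (⊤ : SimpleGraph (Fin s))) ∧
      (ramseyNumber (hypercube n) (⊤ : SimpleGraph (Fin s)) : ℝ) ≤ c * 2 ^ n := by
  obtain ⟨C, w, S, hw⟩ := exists_isWeight (T := s) (by omega)
  refine ⟨C s, fun n => ?_⟩
  have hmem : C s * 2 ^ n ∈
      {N : ℕ | RamseyProperty (hypercube n) (⊤ : SimpleGraph (Fin s)) N} := by
    intro χ
    by_cases hfree : (χ.labelGraph false).CliqueFree s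
    · left
      obtain ⟨f, hf, hadj⟩ := exists_hypercube_of_cliqueFree (n := n) hw (by omega)
        (Fintype.card_fin _) hfree
      refine ⟨⟨⟨f, fun {y z} hyz => ?_⟩, hf⟩⟩
      have hne : f y ≠ f z := hf.ne hyz.ne
      have := hadj y z hyz
      rw [SimpleGraph.TopEdgeLabeling.labelGraph_adj] at this ⊢
      refine ⟨hne, ?_⟩
      by_contra hcol
      exact this ⟨hne, by simpa using hcol⟩
    · right
      rw [SimpleGraph.cliqueFree_iff, not_isEmpty_iff] at hfree
      exact hfree
  refine ⟨⟨Nat.sInf_mem ⟨_, hmem⟩, fun N hN => Nat.sInf_le hN⟩, ?_⟩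
  have : ramseyNumber (hypercube n) (⊤ : SimpleGraph (Fin s)) ≤ C s * 2 ^ n := Nat.sInf_le hmem
  exact_mod_cast this
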